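/- **Setting.** The Levi-Civita field $\mathcal R$ is the set of functions $f:\mathbb Q\to\mathbb R$ whose support is left-finite (for every $r\in\mathbb Q$ only finitely many points of the support are smaller than $r$), with pointwise addition and with multiplication $(f\cdot g)(q)=\sum_{q_1+q_2=q}f(q_1)g(q_2)$. It is an ordered field in which $f\neq 0$ is positive iff $f(\min\operatorname{supp} f)>0$; it carries its order topology. A real number $c$ is identified with the function that is $c$ at $0$ and $0$ elsewhere, and $\tau\in\mathcal R$ is the function that is $1$ at $1$ and $0$ elsewhere. For $m\in\mathbb Z$, $o(\tau^m)$ denotes an element of the form $\sum_{k\ge m+1}a_k\tau^k$ ($k\in\mathbb Z$, $a_k\in\mathbb R$). A network over an ordered field $K$ is a locally finite connected graph on a vertex set $V$ with symmetric weights $\rho_{xy}\in K$, positive on edges and $0$ on non-edges, a vertex $a_0$ and a non-empty set $B\subset V\setminus\{a_0\}$. If $V$ is finite, there is a unique $v:V\to K$ with $\sum_y (v(y)-v(x))\rho_{xy}=0$ for $x\notin B\cup\{a_0\}$, $v=0$ on $B$ and $v(a_0)=1$, and the effective admittance is $\mathcal P_{eff}=\sum_{x\sim a_0}(1-v(x))\rho_{xa_0}$.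 If $V$ is infinite, then (zero potential at infinity) the exhausting finite networks are $\Gamma_n=(V_n,\rho|_{V_n},a_0,(B\cap V_n)\cup\partial V_n)$, $n\ge 1$, where $V_n=\{x:\operatorname{dist}(a_0,x)\le n\}$, $\partial V_n=\{x:\operatorname{dist}(a_0,x)=n\}$ and $\operatorname{dist}$ is the graph distance. **Theorem.** Let $L,C>0$ be real, $\alpha=L^{-1}\tau$ and $\beta=C\tau^{-1}$ in $\mathcal R$. Let $\Gamma$ be Feynman's infinite $LC$ ladder network over $\mathcal R$: its vertices are $a_0,a_1,a_2,\dots,x_1,x_2,\dots$, its weights are $\rho_{a_0x_1}=\rho_{x_ix_{i+1}}=\alpha$ and $\rho_{a_ix_i}=\beta$ for $i\ge1$ (there are no other edges), and $B=\{a_1,a_2,\dots\}$. Let $(\Gamma_n)_{n\ge1}$ be the exhausting finite networks. Then $\frac{\beta}{\alpha}+\left(\frac{\beta}{2\alpha}\right)^2$ has exactly one positive square root $\xi$ in $\mathcal R$; put $\psi_1=1+\frac{\beta}{2\alpha}+\xi$. In the order topology of $\mathcal R$, $$\mathcal P_{eff}(\Gamma_n)\longrightarrow\frac{\beta}{\frac{\beta}{2\alpha}+\xi}\qquad(n\to\infty),$$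 and for every $n\ge1$ $$\mathcal P_{eff}(\Gamma_n)-\frac{\beta}{\frac{\beta}{2\alpha}+\xi}=\frac{2\alpha\xi}{\psi_1^{2n}-1}=\frac{C}{(CL)^{2n}}\,\tau^{4n-1}+o\left(\tau^{4n-1}\right).$$ -/

import Mathlib

open Filter Topology

/-! ### The Levi-Civita field -/

/-- A set of rationals is left-finite if below every rational it has only finitely many elements. -/
def LeftFinite (M : Set ℚ) : Prop :=
  ∀ r : ℚ, (M ∩ Set.Iio r).Finite

theorem LeftFinite.mono {M N : Set ℚ} (hN : LeftFinite N) (h : M ⊆ N) : LeftFinite M :=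
  fun r => (hN r).subset (Set.inter_subset_inter_left _ h)

theorem LeftFinite.of_finite {M : Set ℚ} (h : M.Finite) : LeftFinite M :=
  fun _ => h.inter_of_left _

theorem LeftFinite.union {M N : Set ℚ} (hM : LeftFinite M) (hN : LeftFinite N) :
    LeftFinite (M ∪ N) := by
  intro r
  rw [Set.union_inter_distrib_right]
  exact (hM r).union (hN r)

theorem LeftFinite.bddBelow {M : Set ℚ} (h : LeftFinite M) : ∃ m : ℚ, ∀ q ∈ M, m ≤ q := by
  obtain ⟨m, hm⟩ := (h 0).bddBelow
  refine ⟨min m 0, fun q hq => ?_⟩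
  by_cases h0 : q < 0
  · exact (min_le_left _ _).trans (hm ⟨hq, h0⟩)
  · exact (min_le_right _ _).trans (not_lt.mp h0)

open scoped Pointwise in
theorem LeftFinite.add {M N : Set ℚ} (hM : LeftFinite M) (hN : LeftFinite N) :
    LeftFinite (M + N) := by
  obtain ⟨m, hm⟩ := hM.bddBelow
  obtain ⟨n, hn⟩ := hN.bddBelow
  intro r
  refine ((hM (r - n)).add (hN (r - m))).subset ?_
  rintro _ ⟨⟨a, ha, b, hb, rfl⟩, hr⟩
  have h1 := hm a ha
  have h2 := hn b hb
  have h3 : a + b < r := hr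
  exact ⟨a, ⟨ha, by simp only [Set.mem_Iio]; linarith⟩, b,
    ⟨hb, by simp only [Set.mem_Iio]; linarith⟩, rfl⟩

theorem LeftFinite.mul_support {x y : HahnSeries ℚ ℝ} (hx : LeftFinite x.support)
    (hy : LeftFinite y.support) : LeftFinite (x * y).support :=
  (hx.add hy).mono HahnSeries.support_mul_subset

theorem LeftFinite.single_support (q : ℚ) (c : ℝ) :
    LeftFinite (HahnSeries.single q c).support :=
  LeftFinite.of_finite ((Set.finite_singleton q).subset HahnSeries.support_single_subset)

theorem LeftFinite.sub_support {x y : HahnSeries ℚ ℝ} (hx : LeftFinite x.support)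
    (hy : LeftFinite y.support) : LeftFinite (x - y).support := by
  refine (hx.union hy).mono fun q hq => ?_
  by_contra h
  simp only [Set.mem_union, HahnSeries.mem_support, not_or, not_not] at h
  simp [h.1, h.2] at hq

theorem LeftFinite.pow_support {x : HahnSeries ℚ ℝ} (hx : LeftFinite x.support) (k : ℕ) :
    LeftFinite (x ^ k).support := by
  induction k with
  | zero => rw [pow_zero]; exact LeftFinite.single_support 0 1
  | succ k ih => rw [pow_succ]; exact ih.mul_support hx

theorem LeftFinite.hsum_powers_support {y : HahnSeries ℚ ℝ} (hy : LeftFinite y.support) :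
    LeftFinite (HahnSeries.SummableFamily.powers y).hsum.support := by
  by_cases hpos : 0 < y.orderTop
  swap
  · rw [HahnSeries.SummableFamily.powers_of_not_orderTop_pos hpos]
    simpa using LeftFinite.single_support 0 1
  by_cases h0 : y = 0
  · subst h0
    simpa using LeftFinite.single_support 0 1
  have hord : 0 < y.order := by
    rw [← HahnSeries.order_eq_orderTop_of_ne_zero h0] at hpos
    exact_mod_cast hpos
  intro r
  obtain ⟨N, hN⟩ := exists_nat_gt (r / y.order)
  refine ((Set.finite_Iio N).biUnion fun k _ => hy.pow_support k r).subset ?_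
  rintro q ⟨hq, hqr⟩
  have hqr' : q < r := hqr
  rw [HahnSeries.mem_support, HahnSeries.SummableFamily.coeff_hsum] at hq
  obtain ⟨k, hk⟩ : ∃ k, ((HahnSeries.SummableFamily.powers y) k).coeff q ≠ 0 := by
    by_contra hcon
    push Not at hcon
    exact hq (by rw [finsum_congr hcon, finsum_zero])
  rw [HahnSeries.SummableFamily.powers_of_orderTop_pos hpos] at hk
  have hle := HahnSeries.order_le_of_coeff_ne_zero hk
  rw [HahnSeries.order_pow, nsmul_eq_mul] at hle
  have hkN : (k : ℚ) < N := by
    refine lt_trans ?_ hN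
    rw [lt_div_iff₀ hord]
    linarith
  exact Set.mem_biUnion (Set.mem_Iio.mpr (by exact_mod_cast hkN)) ⟨hk, hqr⟩

theorem LeftFinite.inv_support {x : HahnSeries ℚ ℝ} (hx : LeftFinite x.support) :
    LeftFinite (x⁻¹).support := by
  rw [HahnSeries.inv_def]
  refine (LeftFinite.single_support _ _).mul_support (LeftFinite.hsum_powers_support ?_)
  exact LeftFinite.sub_support (LeftFinite.single_support 0 1)
    ((LeftFinite.single_support _ _).mul_support hx)

/-- The functions `ℚ → ℝ` with left-finite support, as a subfield of the Hahn series field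
`ℝ⟦ℚ⟧` with its lexicographic order (a left-finite set is well-ordered, so every such function
is the coefficient function of a Hahn series).  Addition is pointwise, multiplication is
convolution, and an element is positive iff its coefficient at the least point of its support
is positive. -/
noncomputable def leviCivitaSubfield : Subfield (Lex (HahnSeries ℚ ℝ)) where
  carrier := {x | LeftFinite (ofLex x).support}
  mul_mem' hx hy := LeftFinite.mul_support hx hy
  one_mem' := LeftFinite.single_support 0 1
  add_mem' hx hy := (LeftFinite.union hx hy).mono (HahnSeries.support_add_subset _ _)
  zero_mem' := LeftFinite.of_finite (by simp)
  neg_mem' {x} hx := by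
    have h : (ofLex (-x)).support = (ofLex x).support := by
      rw [ofLex_neg, HahnSeries.support_neg]
    simpa only [Set.mem_ofPred_eq, h] using hx
  inv_mem' _ hx := LeftFinite.inv_support hx

/-- The Levi-Civita field, an ordered field. -/
abbrev LeviCivita : Type := leviCivitaSubfield

namespace LeviCivita

/-- The order topology of the Levi-Civita field. -/
instance : TopologicalSpace LeviCivita := Preorder.topology LeviCivita

instance : OrderTopology LeviCivita := ⟨rfl⟩

/-- The function `ℚ → ℝ` underlying an element of the Levi-Civita field. -/
def coeff (x : LeviCivita) (q : ℚ) : ℝ := (ofLex (x : Lex (HahnSeries ℚ ℝ))).coeff q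

/-- The function with value `c` at `q` and `0` elsewhere. -/
noncomputable def monomial (q : ℚ) (c : ℝ) : LeviCivita :=
  ⟨toLex (HahnSeries.single q c), LeftFinite.single_support q c⟩

/-- The real number `c` as an element of the Levi-Civita field. -/
noncomputable def ofReal (c : ℝ) : LeviCivita := monomial 0 c

/-- The infinitesimal `τ`: the function with value `1` at `1` and `0` elsewhere. -/
noncomputable def τ : LeviCivita := monomial 1 1

/-- `x = o(τ ^ m)`, meaning that `x` is a series `∑ aₖ τ ^ k` over the integers `k ≥ m + 1`. -/
def IsLittleOTau (x : LeviCivita) (m : ℤ) : Prop :=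
  ∀ q : ℚ, x.coeff q ≠ 0 → ∃ k : ℤ, m + 1 ≤ k ∧ q = k

theorem monomial_pos {q : ℚ} {c : ℝ} (hc : 0 < c) : 0 < monomial q c := by
  change (0 : Lex (HahnSeries ℚ ℝ)) < toLex (HahnSeries.single q c)
  rw [← HahnSeries.leadingCoeff_pos_iff]
  simpa using hc

theorem ofReal_pos {c : ℝ} (hc : 0 < c) : 0 < ofReal c := monomial_pos hc

theorem τ_pos : 0 < τ := monomial_pos one_pos

end LeviCivita

/-! ### Networks over an ordered field -/

/-- A network over the ordered field `K`: a locally finite connected graph on `V` with positive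
edge weights (admittances), extended by `0` to the pairs that are not edges, a vertex `a₀` and a
nonempty set `B` of further vertices.  (`V` then has at least two elements.) -/
structure Network (K : Type*) [Field K] [LinearOrder K] (V : Type*) where
  graph : SimpleGraph V
  connected : graph.Connected
  locallyFinite : ∀ x, (graph.neighborSet x).Finite
  ρ : V → V → K
  ρ_symm : ∀ x y, ρ x y = ρ y x
  ρ_pos : ∀ x y, graph.Adj x y → 0 < ρ x y
  ρ_eq_zero : ∀ x y, ¬ graph.Adj x y → ρ x y = 0
  a₀ : V
  B : Set V
  B_nonempty : B.Nonempty
  a₀_notMem_B : a₀ ∉ B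

namespace Network

variable {K : Type*} [Field K] [LinearOrder K] {V : Type*}

/-- The boundary `B₀ = B ∪ {a₀}`. -/
def boundary (Γ : Network K V) : Set V := Γ.B ∪ {Γ.a₀}

/-- The Laplace operator `Δ_ρ v (x) = ∑_y (v(y) - v(x)) ρ_{xy}` (a finite sum, by local
finiteness). -/
noncomputable def laplacian (Γ : Network K V) (v : V → K) (x : V) : K :=
  ∑ᶠ y, (v y - v x) * Γ.ρ x y

/-- `v` solves the Dirichlet problem: it is harmonic off the boundary, `0` on `B` and `1` at
`a₀`. -/
def IsDirichletSolution (Γ : Network K V) (v : V → K) : Prop :=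
  (∀ x, x ∉ Γ.boundary → Γ.laplacian v x = 0) ∧ (∀ x ∈ Γ.B, v x = 0) ∧ v Γ.a₀ = 1

/-! #### The finite networks exhausting an infinite network -/

/-- `V_n`, the set of the vertices at distance at most `n` from `a₀`. -/
def ball (Γ : Network K V) (n : ℕ) : Set V := {x | Γ.graph.dist Γ.a₀ x ≤ n}

/-- `∂V_n`, the set of the vertices at distance exactly `n` from `a₀`. -/
def sphere (Γ : Network K V) (n : ℕ) : Set V := {x | Γ.graph.dist Γ.a₀ x = n}

theorem exists_pred (Γ : Network K V) {n : ℕ} {x : V} (hx : Γ.graph.dist Γ.a₀ x = n + 1) :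
    ∃ y, Γ.graph.Adj y x ∧ Γ.graph.dist Γ.a₀ y = n := by
  obtain ⟨p, hp⟩ := Γ.connected.exists_walk_length_eq_dist x Γ.a₀
  rw [SimpleGraph.dist_comm, hx] at hp
  cases p with
  | nil => simp at hp
  | @cons _ y _ h q =>
    rw [SimpleGraph.Walk.length_cons] at hp
    have h1 : Γ.graph.dist Γ.a₀ y ≤ n := by
      rw [SimpleGraph.dist_comm]
      exact (SimpleGraph.dist_le q).trans (by omega)
    rcases h.symm.diff_dist_adj (u := Γ.a₀) with h2 | h2 | h2 <;>
      exact ⟨y, h.symm, by omega⟩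

theorem ball_finite (Γ : Network K V) (n : ℕ) : (Γ.ball n).Finite := by
  induction n with
  | zero =>
    refine (Set.finite_singleton Γ.a₀).subset fun x hx => ?_
    have h0 : Γ.graph.dist Γ.a₀ x = 0 := Nat.le_zero.mp hx
    exact (Γ.connected.dist_eq_zero_iff.mp h0).symm
  | succ n ih =>
    refine (ih.union (ih.biUnion fun y _ => Γ.locallyFinite y)).subset fun x hx => ?_
    rcases Nat.lt_or_ge n (Γ.graph.dist Γ.a₀ x) with h | h
    · have hx' : Γ.graph.dist Γ.a₀ x ≤ n + 1 := hx
      obtain ⟨y, hy, hd⟩ := Γ.exists_pred (n := n) (x := x) (by omega)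
      exact Or.inr (Set.mem_biUnion (show y ∈ Γ.ball n from hd.le) hy)
    · exact Or.inl h

instance (Γ : Network K V) (n : ℕ) : Finite (Γ.ball n) := (Γ.ball_finite n).to_subtype

theorem a₀_mem_ball (Γ : Network K V) (n : ℕ) : Γ.a₀ ∈ Γ.ball n := by
  simp [ball]

theorem sphere_nonempty [Infinite V] (Γ : Network K V) (n : ℕ) : (Γ.sphere n).Nonempty := by
  obtain ⟨x, hx⟩ := (Γ.ball_finite n).exists_notMem
  have key : ∀ k x, Γ.graph.dist Γ.a₀ x = n + k → (Γ.sphere n).Nonempty := by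
    intro k
    induction k with
    | zero => exact fun x hx => ⟨x, hx⟩
    | succ k ih =>
      intro x hx
      obtain ⟨y, _, hy⟩ := Γ.exists_pred (n := n + k) (x := x) (by omega)
      exact ih y hy
  have hx' : n < Γ.graph.dist Γ.a₀ x := not_le.mp hx
  exact key (Γ.graph.dist Γ.a₀ x - n) x (by omega)

theorem ball_connected (Γ : Network K V) (n : ℕ) : (Γ.graph.induce (Γ.ball n)).Connected := by
  rw [SimpleGraph.connected_iff_exists_forall_reachable]
  refine ⟨⟨Γ.a₀, Γ.a₀_mem_ball n⟩, ?_⟩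
  have key : ∀ k x, Γ.graph.dist Γ.a₀ x = k → ∀ hx : x ∈ Γ.ball n,
      (Γ.graph.induce (Γ.ball n)).Reachable ⟨Γ.a₀, Γ.a₀_mem_ball n⟩ ⟨x, hx⟩ := by
    intro k
    induction k with
    | zero =>
      intro x h0 hx
      obtain rfl := Γ.connected.dist_eq_zero_iff.mp h0
      exact SimpleGraph.Reachable.refl _
    | succ k ih =>
      intro x hk hx
      obtain ⟨y, hyx, hy⟩ := Γ.exists_pred hk
      have hx' : Γ.graph.dist Γ.a₀ x ≤ n := hx
      have hyb : y ∈ Γ.ball n := show Γ.graph.dist Γ.a₀ y ≤ n by omega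
      have hadj : (Γ.graph.induce (Γ.ball n)).Adj ⟨y, hyb⟩ ⟨x, hx⟩ := hyx
      exact (ih y hy hyb).trans hadj.reachable
  exact fun x => key _ x rfl x.2

/-- The finite network `Γ_n = (V_n, ρ|_{V_n}, a₀, (B ∩ V_n) ∪ ∂V_n)`, `n ≥ 1`. -/
def exhaustion [Infinite V] (Γ : Network K V) (n : ℕ+) : Network K (Γ.ball n) where
  graph := Γ.graph.induce (Γ.ball n)
  connected := Γ.ball_connected n
  locallyFinite _ := Set.toFinite _
  ρ x y := Γ.ρ x y
  ρ_symm x y := Γ.ρ_symm x y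
  ρ_pos x y h := Γ.ρ_pos x y h
  ρ_eq_zero x y h := Γ.ρ_eq_zero x y h
  a₀ := ⟨Γ.a₀, Γ.a₀_mem_ball n⟩
  B := {x | (x : V) ∈ Γ.B ∪ Γ.sphere n}
  B_nonempty := by
    obtain ⟨x, hx⟩ := Γ.sphere_nonempty n
    exact ⟨⟨x, le_of_eq hx⟩, Or.inr hx⟩
  a₀_notMem_B := by
    rintro (h | h)
    · exact Γ.a₀_notMem_B h
    · have h' : Γ.graph.dist Γ.a₀ Γ.a₀ = n := h
      rw [SimpleGraph.dist_self] at h'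
      exact n.ne_zero h'.symm

/-! #### The Dirichlet problem on a finite network -/

variable [IsStrictOrderedRing K]

theorem harmonic_le_zero [Finite V] (Γ : Network K V) (v : V → K)
    (hv : ∀ x, x ∉ Γ.boundary → Γ.laplacian v x = 0) (hb : ∀ x ∈ Γ.boundary, v x = 0) (x : V) :
    v x ≤ 0 := by
  have := Fintype.ofFinite V
  have : Nonempty V := ⟨x⟩
  obtain ⟨m, hm⟩ := Finite.exists_max v
  suffices h : v m ≤ 0 from (hm x).trans h
  by_contra hpos
  push Not at hpos
  have step : ∀ y z, Γ.graph.Adj y z → v y = v m → v z = v m := by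
    intro y z hyz hy
    have hyb : y ∉ Γ.boundary := fun h => by rw [← hy, hb y h] at hpos; exact lt_irrefl _ hpos
    have h0 := hv y hyb
    rw [laplacian, finsum_eq_sum_of_fintype, Finset.sum_eq_zero_iff_of_nonpos] at h0
    · have h1 := h0 z (Finset.mem_univ z)
      rcases mul_eq_zero.mp h1 with h2 | h2
      · rw [sub_eq_zero.mp h2, hy]
      · exact absurd h2 (Γ.ρ_pos y z hyz).ne'
    · intro w _
      refine mul_nonpos_of_nonpos_of_nonneg (by rw [hy]; exact sub_nonpos.mpr (hm w)) ?_
      by_cases hw : Γ.graph.Adj y w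
      · exact (Γ.ρ_pos y w hw).le
      · rw [Γ.ρ_eq_zero y w hw]
  have walk : ∀ y z, Γ.graph.Walk y z → v y = v m → v z = v m := by
    intro y z p
    induction p with
    | nil => exact id
    | cons h _ ih => exact fun hy => ih (step _ _ h hy)
  obtain ⟨p⟩ := Γ.connected.preconnected m Γ.a₀
  have := walk _ _ p rfl
  rw [hb Γ.a₀ (Or.inr rfl)] at this
  exact hpos.ne this

/-- On a finite network the Dirichlet problem has exactly one solution. -/
theorem existsUnique_dirichletSolution [Finite V] (Γ : Network K V) :
    ∃! v : V → K, Γ.IsDirichletSolution v := by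
  classical
  have := Fintype.ofFinite V
  let T : (V → K) →ₗ[K] (V → K) :=
    { toFun := fun v x => if x ∈ Γ.boundary then v x else Γ.laplacian v x
      map_add' := by
        intro v w
        funext x
        by_cases hx : x ∈ Γ.boundary
        · simp [hx]
        · simp only [hx, if_false, Pi.add_apply, laplacian, finsum_eq_sum_of_fintype]
          rw [← Finset.sum_add_distrib]
          exact Finset.sum_congr rfl fun y _ => by ring
      map_smul' := by
        intro c v
        funext x
        by_cases hx : x ∈ Γ.boundary
        · simp [hx]
        · simp only [hx, if_false, Pi.smul_apply, laplacian, finsum_eq_sum_of_fintype,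
            smul_eq_mul, RingHom.id_apply]
          rw [Finset.mul_sum]
          exact Finset.sum_congr rfl fun y _ => by ring }
  have hT : ∀ v x, T v x = if x ∈ Γ.boundary then v x else Γ.laplacian v x := fun _ _ => rfl
  have hker : ∀ v, T v = 0 → ∀ x, v x ≤ 0 := by
    intro v hv
    refine Γ.harmonic_le_zero v (fun x hx => ?_) fun x hx => ?_
    · have := congrFun hv x
      rwa [hT, if_neg hx] at this
    · have := congrFun hv x
      rwa [hT, if_pos hx] at this
  have hinj : Function.Injective T := by
    rw [injective_iff_map_eq_zero]
    intro v hv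
    funext x
    refine le_antisymm (hker v hv x) ?_
    have := hker (-v) (by rw [map_neg, hv, neg_zero]) x
    simpa using this
  have hiff : ∀ v, Γ.IsDirichletSolution v ↔ T v = Pi.single Γ.a₀ 1 := by
    intro v
    constructor
    · rintro ⟨h1, h2, h3⟩
      funext x
      rw [hT]
      by_cases hx : x ∈ Γ.boundary
      · rw [if_pos hx]
        rcases hx with hx | hx
        · rw [h2 x hx, Pi.single_eq_of_ne]
          rintro rfl
          exact Γ.a₀_notMem_B hx
        · rw [Set.mem_singleton_iff.mp hx, h3, Pi.single_eq_same]
      · rw [if_neg hx, h1 x hx, Pi.single_eq_of_ne]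
        rintro rfl
        exact hx (Or.inr rfl)
    · intro h
      have h' : ∀ x, (if x ∈ Γ.boundary then v x else Γ.laplacian v x) =
          (Pi.single Γ.a₀ 1 : V → K) x := fun x => by rw [← hT, h]
      refine ⟨fun x hx => ?_, fun x hx => ?_, ?_⟩
      · have := h' x
        rwa [if_neg hx, Pi.single_eq_of_ne] at this
        rintro rfl
        exact hx (Or.inr rfl)
      · have := h' x
        rwa [if_pos (show x ∈ Γ.boundary from Or.inl hx), Pi.single_eq_of_ne] at this
        rintro rfl
        exact Γ.a₀_notMem_B hx
      · have := h' Γ.a₀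
        rwa [if_pos (show Γ.a₀ ∈ Γ.boundary from Or.inr rfl), Pi.single_eq_same] at this
  obtain ⟨v, hv⟩ := LinearMap.injective_iff_surjective.mp hinj (Pi.single Γ.a₀ 1)
  exact ⟨v, (hiff v).mpr hv, fun w hw => hinj (((hiff w).mp hw).trans hv.symm)⟩

/-- The solution of the Dirichlet problem on a finite network. -/
noncomputable def potential [Finite V] (Γ : Network K V) : V → K :=
  Γ.existsUnique_dirichletSolution.choose

/-- The effective admittance of a finite network, `∑_{x ∼ a₀} (1 - v(x)) ρ_{x a₀}` with `v` the
solution of the Dirichlet problem. -/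
noncomputable def effectiveAdmittance [Finite V] (Γ : Network K V) : K :=
  ∑ᶠ x, (1 - Γ.potential x) * Γ.ρ x Γ.a₀

end Network

/-! ### The ladder network -/

/-- The vertices `a₀, a₁, a₂, …` and `x₁, x₂, …` of the ladder; `a i` is `a_i` and `x i` is
`x_{i+1}`. -/
inductive LadderVertex : Type
  | a (i : ℕ)
  | x (i : ℕ)

namespace LadderVertex

instance : Infinite LadderVertex :=
  Infinite.of_injective LadderVertex.a fun _ _ h => LadderVertex.a.inj h

/-- The edges are `a₀x₁`, `x_i x_{i+1}` and `a_i x_i` for `i ≥ 1`. -/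
def Adj : LadderVertex → LadderVertex → Prop
  | a i, x j => (i = 0 ∧ j = 0) ∨ i = j + 1
  | x j, a i => (i = 0 ∧ j = 0) ∨ i = j + 1
  | x i, x j => j = i + 1 ∨ i = j + 1
  | a _, a _ => False

/-- The ladder graph. -/
def graph : SimpleGraph LadderVertex where
  Adj := Adj
  symm := by
    refine ⟨?_⟩
    rintro (i | i) (j | j) h
    · exact h
    · exact h
    · exact h
    · exact Or.symm h
  loopless := by
    refine ⟨?_⟩
    rintro (i | i) h
    · exact h
    · rcases h with h | h <;> omega

theorem graph_connected : graph.Connected := by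
  rw [SimpleGraph.connected_iff_exists_forall_reachable]
  refine ⟨a 0, ?_⟩
  have hx : ∀ i, graph.Reachable (a 0) (x i) := by
    intro i
    induction i with
    | zero =>
      have h : graph.Adj (a 0) (x 0) := Or.inl ⟨rfl, rfl⟩
      exact h.reachable
    | succ i ih =>
      have h : graph.Adj (x i) (x (i + 1)) := Or.inl rfl
      exact ih.trans h.reachable
  rintro (i | i)
  · rcases i with _ | i
    · exact SimpleGraph.Reachable.refl _
    · have h : graph.Adj (x i) (a (i + 1)) := Or.inr rfl
      exact (hx i).trans h.reachable
  · exact hx i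

theorem graph_locallyFinite (v : LadderVertex) : (graph.neighborSet v).Finite := by
  rcases v with i | i
  · refine (((Set.finite_Iic i).image x)).subset ?_
    rintro (j | j) h
    · exact h.elim
    · refine ⟨j, ?_, rfl⟩
      rcases h with h | h <;> simp only [Set.mem_Iic] <;> omega
  · refine (((Set.finite_Iic (i + 1)).image a).union ((Set.finite_Iic (i + 1)).image x)).subset ?_
    rintro (j | j) h
    · refine Or.inl ⟨j, ?_, rfl⟩
      rcases h with h | h <;> simp only [Set.mem_Iic] <;> omega
    · refine Or.inr ⟨j, ?_, rfl⟩
      rcases h with h | h <;> simp only [Set.mem_Iic] <;> omega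

/-- The admittances of the `αβ`-network: `ρ(a₀x₁) = ρ(x_i x_{i+1}) = α` and `ρ(a_i x_i) = β` for
`i ≥ 1`, and `0` for all other pairs. -/
def weight {K : Type*} [Zero K] (α β : K) : LadderVertex → LadderVertex → K
  | a i, x j => if i = 0 ∧ j = 0 then α else if i = j + 1 then β else 0
  | x j, a i => if i = 0 ∧ j = 0 then α else if i = j + 1 then β else 0
  | x i, x j => if j = i + 1 ∨ i = j + 1 then α else 0
  | a _, a _ => 0

end LadderVertex

/-- The infinite ladder (the `αβ`-network), with `B = {a₁, a₂, …}`. -/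
def ladderNetwork {K : Type*} [Field K] [LinearOrder K] (α β : K) (hα : 0 < α) (hβ : 0 < β) :
    Network K LadderVertex where
  graph := LadderVertex.graph
  connected := LadderVertex.graph_connected
  locallyFinite := LadderVertex.graph_locallyFinite
  ρ := LadderVertex.weight α β
  ρ_symm := by
    rintro (i | i) (j | j)
    · rfl
    · rfl
    · rfl
    · simp only [LadderVertex.weight, or_comm]
  ρ_pos := by
    rintro (i | i) (j | j) h
    · exact h.elim
    · have h' : (i = 0 ∧ j = 0) ∨ i = j + 1 := h
      simp only [LadderVertex.weight]
      split_ifs <;> first | assumption | (exfalso; tauto)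
    · have h' : (j = 0 ∧ i = 0) ∨ j = i + 1 := h
      simp only [LadderVertex.weight]
      split_ifs <;> first | assumption | (exfalso; tauto)
    · have h' : j = i + 1 ∨ i = j + 1 := h
      simp only [LadderVertex.weight, if_pos h']
      exact hα
  ρ_eq_zero := by
    rintro (i | i) (j | j) h
    · rfl
    · have h' : ¬ ((i = 0 ∧ j = 0) ∨ i = j + 1) := h
      simp only [LadderVertex.weight]
      rw [if_neg (fun h1 => h' (Or.inl h1)), if_neg (fun h1 => h' (Or.inr h1))]
    · have h' : ¬ ((j = 0 ∧ i = 0) ∨ j = i + 1) := h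
      simp only [LadderVertex.weight]
      rw [if_neg (fun h1 => h' (Or.inl h1)), if_neg (fun h1 => h' (Or.inr h1))]
    · have h' : ¬ (j = i + 1 ∨ i = j + 1) := h
      simp only [LadderVertex.weight, if_neg h']
  a₀ := LadderVertex.a 0
  B := {v | ∃ i : ℕ, v = LadderVertex.a (i + 1)}
  B_nonempty := ⟨LadderVertex.a 1, 0, rfl⟩
  a₀_notMem_B := by
    rintro ⟨i, hi⟩
    exact absurd (LadderVertex.a.inj hi) (by omega)

/-- Admittance `L⁻¹ τ` of a coil. -/
noncomputable def coilAdmittance (L : ℝ) : LeviCivita := LeviCivita.ofReal L⁻¹ * LeviCivita.τ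

/-- Admittance `C τ⁻¹` of a capacitor. -/
noncomputable def capacitorAdmittance (C : ℝ) : LeviCivita :=
  LeviCivita.ofReal C * LeviCivita.τ⁻¹

/-- Feynman's infinite `LC` ladder network: the `αβ`-network over the Levi-Civita field with
`α = L⁻¹ τ` and `β = C τ⁻¹`. -/
noncomputable def feynmanLadder (L C : ℝ) (hL : 0 < L) (hC : 0 < C) :
    Network LeviCivita LadderVertex :=
  ladderNetwork (coilAdmittance L) (capacitorAdmittance C)
    (mul_pos (LeviCivita.ofReal_pos (inv_pos.mpr hL)) LeviCivita.τ_pos)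
    (mul_pos (LeviCivita.ofReal_pos hC) (inv_pos.mpr LeviCivita.τ_pos))

/-! The chain vertices of a ladder obey a linear recurrence with constant coefficients. Its
characteristic equation `α (ψ² + 1) = (2α + β) ψ` has two reciprocal roots, `ψ` and `ψ⁻¹`. In `Γ_n`
the chain is grounded at its `n`-th vertex, since only that chain vertex is at distance `n` from
`a₀`. So the potential is the combination of `ψ ^ i` and `ψ ^ (-i)` that is `1` at `i = 0` and `0`
at `i = n`. Uniqueness of the Dirichlet solution turns this guess into a closed form for the
admittance over any ordered field (`effectiveAdmittance_exhaustion_ladderNetwork_of_root`). With `ψ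
= 1 + β/(2α) + ξ`, this closed form is the claimed limit plus `2αξ / (ψ ^ (2n) - 1)`.

The limit is specific to the Levi-Civita field: in a non-Archimedean field `1 < ψ` does not make the
powers of `ψ` unbounded. Here `β/(2α) = (CL/2) τ⁻²`, and `ξ` is this element times a power series in
`τ` with constant coefficient `1` (`exists_powerSeries_sqrt`). Hence `ψ` is infinitely large with
leading term `CL τ⁻²`, and the deviation is `τ ^ (4n - 1)` times a power series with constant
coefficient `C / (CL) ^ (2n)` (`exists_deviation_eq_τ_zpow_mul_ofPowerSeries`). This gives the
leading term. It also gives convergence, because in the order topology a sequence whose least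
exponents tend to infinity tends to `0` (`tendsto_τ_zpow_mul_ofPowerSeries`). -/

/-! ### Exhausting networks -/

namespace Network

variable {K : Type*} [Field K] [LinearOrder K] {V : Type*}

/-- A function that is `0` at `a₀` and grows by at most `1` along edges is bounded by the distance
from `a₀`. -/
theorem le_dist_of_adj_le (Γ : Network K V) (h : V → ℕ) (h0 : h Γ.a₀ = 0)
    (hadj : ∀ x y, Γ.graph.Adj x y → h y ≤ h x + 1) (x : V) : h x ≤ Γ.graph.dist Γ.a₀ x := by
  have key : ∀ n x, Γ.graph.dist Γ.a₀ x = n → h x ≤ n := by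
    intro n
    induction n with
    | zero =>
      intro x hx
      rw [← Γ.connected.dist_eq_zero_iff.mp hx, h0]
    | succ n ih =>
      intro x hx
      obtain ⟨y, hyx, hy⟩ := Γ.exists_pred hx
      exact (hadj y x hyx).trans (Nat.succ_le_succ (ih y hy))
  exact key _ x rfl

theorem dist_le_succ_of_adj (Γ : Network K V) {x y : V} (h : Γ.graph.Adj x y) :
    Γ.graph.dist Γ.a₀ y ≤ Γ.graph.dist Γ.a₀ x + 1 := by
  rcases h.diff_dist_adj (u := Γ.a₀) with h | h | h <;> omega

/-- At a vertex that is not on the outer sphere, the Laplace operator of `Γ_n` is that of `Γ`. -/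
theorem laplacian_exhaustion [Infinite V] (Γ : Network K V) (n : ℕ+) (v : V → K) (x : Γ.ball n)
    (hx : (x : V) ∉ Γ.sphere n) :
    (Γ.exhaustion n).laplacian (fun y => v y) x = Γ.laplacian v x := by
  have hlt : Γ.graph.dist Γ.a₀ x < n := lt_of_le_of_ne x.2 hx
  change ∑ᶠ y : Γ.ball n, (v y - v x) * Γ.ρ x y = ∑ᶠ y, (v y - v x) * Γ.ρ x y
  rw [finsum_set_coe_eq_finsum_mem (f := fun y => (v y - v x) * Γ.ρ x y),
    ← finsum_mem_univ (fun y => (v y - v x) * Γ.ρ x y)]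
  -- All neighbours of a vertex at distance less than `n` lie in the ball, so restricting the sum to
  -- the ball drops only zero terms.
  refine finsum_mem_inter_support_eq' _ _ _ fun y hy => ⟨fun _ => trivial, fun _ => ?_⟩
  have hadj : Γ.graph.Adj x y := by
    by_contra hn
    exact hy (by simp only [Γ.ρ_eq_zero _ _ hn, mul_zero])
  exact (Γ.dist_le_succ_of_adj hadj).trans hlt

theorem IsDirichletSolution.potential_eq [IsStrictOrderedRing K] [Finite V] {Γ : Network K V}
    {v : V → K} (hv : Γ.IsDirichletSolution v) : Γ.potential = v :=
  Γ.existsUnique_dirichletSolution.unique Γ.existsUnique_dirichletSolution.choose_spec.1 hv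

end Network

/-! ### The finite ladders -/

namespace LadderVertex

/-- The distance of a vertex of the ladder from `a₀`. -/
def depth : LadderVertex → ℕ
  | a 0 => 0
  | a (i + 1) => i + 2
  | x i => i + 1

/-- The potential that is `u i` at `x_i`, `1` at `a₀` and `0` at the other `a_i`. -/
def ladderPotential {K : Type*} [Zero K] [One K] (u : ℕ → K) : LadderVertex → K
  | a 0 => 1
  | a (_ + 1) => 0
  | x i => u (i + 1)

theorem depth_le_succ_of_adj : ∀ v w, graph.Adj v w → depth w ≤ depth v + 1 := by
  rintro ((_ | i) | i) ((_ | j) | j) h <;> simp only [depth] <;>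
    first
    | exact h.elim
    | (rcases h with h | h <;> omega)

end LadderVertex

section Ladder

open LadderVertex

variable {K : Type*} [Field K] [LinearOrder K] (α β : K) (hα : 0 < α) (hβ : 0 < β)

/-- `depth` bounds the distance from below, and the path along the chain bounds it from above.
Distances to the `a (i + 1)` are not needed: these vertices are grounded whether or not they lie on
the sphere. -/
theorem ladderNetwork_dist_x (i : ℕ) :
    (ladderNetwork α β hα hβ).graph.dist (ladderNetwork α β hα hβ).a₀ (x i) = i + 1 := by
  refine le_antisymm ?_ ((ladderNetwork α β hα hβ).le_dist_of_adj_le depth rfl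
    depth_le_succ_of_adj (x i))
  induction i with
  | zero =>
    have h : (ladderNetwork α β hα hβ).graph.Adj (ladderNetwork α β hα hβ).a₀ (x 0) :=
      Or.inl ⟨rfl, rfl⟩
    simpa using (ladderNetwork α β hα hβ).dist_le_succ_of_adj h
  | succ i ih =>
    have h : (ladderNetwork α β hα hβ).graph.Adj (x i) (x (i + 1)) := Or.inl rfl
    exact ((ladderNetwork α β hα hβ).dist_le_succ_of_adj h).trans (Nat.succ_le_succ ih)

/-- The convention `u 0 = 1` lets `a₀` act as the zeroth chain vertex, so `x 0`, whose left
neighbour is `a 0`, satisfies the same recurrence as the others. The rung contributes `-u (i + 1) *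
β` because its far end is grounded. -/
theorem ladderNetwork_laplacian_x (u : ℕ → K) (hu : u 0 = 1) (i : ℕ) :
    (ladderNetwork α β hα hβ).laplacian (ladderPotential u) (x i) =
      (u i - u (i + 1)) * α + (u (i + 2) - u (i + 1)) * α - u (i + 1) * β := by
  classical
  change ∑ᶠ y, (ladderPotential u y - ladderPotential u (x i)) * weight α β (x i) y = _
  have hsupp : ∀ s : Finset LadderVertex, (∀ y, graph.Adj (x i) y → y ∈ s) →
      ∑ᶠ y, (ladderPotential u y - ladderPotential u (x i)) * weight α β (x i) y =
        ∑ y ∈ s, (ladderPotential u y - ladderPotential u (x i)) * weight α β (x i) y := by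
    intro s hs
    refine finsum_eq_sum_of_support_subset _ fun y hy => hs y ?_
    by_contra hn
    exact hy (by
      simp only [show weight α β (x i) y = 0 from (ladderNetwork α β hα hβ).ρ_eq_zero _ _ hn,
        mul_zero])
  rcases i with _ | i
  · rw [hsupp {a 0, x 1, a 1}]
    · simp [ladderPotential, weight, hu]
      ring
    · rintro (j | j) h
      · rcases h with h | h
        · simp [h.1]
        · simp [h]
      · rcases h with h | h
        · simp [h]
        · omega
  · rw [hsupp {x i, x (i + 2), a (i + 2)}]
    · simp [ladderPotential, weight]
      ring
    · rintro (j | j) h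
      · rcases h with h | h
        · omega
        · simp [h]
      · rcases h with h | h
        · simp [h]
        · have : j = i := by omega
          simp [this]

/-- The effective admittance of a finite ladder in terms of the potentials `u i` of the
vertices `x_i`. -/
theorem effectiveAdmittance_exhaustion_ladderNetwork [IsStrictOrderedRing K] (n : ℕ+)
    (u : ℕ → K) (hu0 : u 0 = 1) (hun : u n = 0)
    (hu : ∀ i, (u i - u (i + 1)) * α + (u (i + 2) - u (i + 1)) * α - u (i + 1) * β = 0) :
    ((ladderNetwork α β hα hβ).exhaustion n).effectiveAdmittance = (1 - u 1) * α := by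
  have hsol : ((ladderNetwork α β hα hβ).exhaustion n).IsDirichletSolution
      (fun y => ladderPotential u y) := by
    refine ⟨?_, ?_, rfl⟩
    · intro y hy
      have hyB : (y : LadderVertex) ∉
          (ladderNetwork α β hα hβ).B ∪ (ladderNetwork α β hα hβ).sphere n :=
        fun h => hy (Or.inl h)
      rw [(ladderNetwork α β hα hβ).laplacian_exhaustion n _ y fun h => hyB (Or.inr h)]
      obtain ⟨(_ | i) | i, hmem⟩ := y
      · exact absurd (Or.inr rfl) hy
      · exact absurd (Or.inl ⟨i, rfl⟩) hyB
      · rw [ladderNetwork_laplacian_x α β hα hβ u hu0, hu]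
    · rintro ⟨(_ | i) | i, hmem⟩ (h | h)
      · exact absurd h (ladderNetwork α β hα hβ).a₀_notMem_B
      · have h' : (ladderNetwork α β hα hβ).graph.dist (ladderNetwork α β hα hβ).a₀
            (ladderNetwork α β hα hβ).a₀ = n := h
        rw [SimpleGraph.dist_self] at h'
        exact absurd h'.symm n.ne_zero
      · rfl
      · rfl
      · obtain ⟨j, hj⟩ := h
        cases hj
      · have h' : (ladderNetwork α β hα hβ).graph.dist (ladderNetwork α β hα hβ).a₀ (x i) = n := h
        rw [ladderNetwork_dist_x] at h'
        change u (i + 1) = 0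
        rw [h', hun]
  rw [Network.effectiveAdmittance, hsol.potential_eq]
  -- `x 0` is the only neighbour of `a₀`. For `n = 1` it lies on the sphere itself, and `hun` then
  -- says `u 1 = 0`.
  have hx0 : x 0 ∈ (ladderNetwork α β hα hβ).ball n := by
    refine (ladderNetwork_dist_x α β hα hβ 0).trans_le ?_
    exact n.pos
  rw [finsum_eq_single _ (⟨x 0, hx0⟩ : (ladderNetwork α β hα hβ).ball n)]
  · change (1 - u 1) * weight α β (x 0) (a 0) = _
    simp [weight]
  · rintro ⟨i | i, hmem⟩ hne
    · change _ * weight α β (a i) (a 0) = 0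
      simp [weight]
    · change _ * weight α β (x i) (a 0) = 0
      have : i ≠ 0 := by
        rintro rfl
        exact hne rfl
      simp [weight, this]

/-- The effective admittance of a finite ladder, by means of a root `ψ` of the characteristic
equation. -/
theorem effectiveAdmittance_exhaustion_ladderNetwork_of_root [IsStrictOrderedRing K] (n : ℕ+)
    (ψ : K) (hψ1 : 1 < ψ) (hψ : α * (ψ ^ 2 + 1) = (2 * α + β) * ψ) :
    ((ladderNetwork α β hα hβ).exhaustion n).effectiveAdmittance =
      α * (1 - ψ⁻¹) + α * (ψ - ψ⁻¹) / (ψ ^ (2 * (n : ℕ)) - 1) := by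
  have h0 : ψ ≠ 0 := (zero_lt_one.trans hψ1).ne'
  have hn : ψ ^ (2 * (n : ℕ)) - 1 ≠ 0 :=
    (sub_pos.mpr (one_lt_pow₀ hψ1 (by have := n.pos; omega))).ne'
  have hβ' : β = α * (ψ ^ 2 + 1) / ψ - 2 * α := by
    field_simp
    linear_combination -hψ
  -- The solution of the recurrence with `u 0 = 1` and `u n = 0`. The factor `(ψ ^ i)⁻¹` replaces `ψ
  -- ^ (2 * n - i)`, which would truncate, since the recurrence is required for every `i`.
  rw [effectiveAdmittance_exhaustion_ladderNetwork α β hα hβ n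
    (fun i => (ψ ^ (2 * (n : ℕ)) * (ψ ^ i)⁻¹ - ψ ^ i) / (ψ ^ (2 * (n : ℕ)) - 1))]
  · field_simp
    ring
  · field_simp
  · field_simp
    ring
  · intro i
    rw [hβ']
    field_simp
    ring

end Ladder

/-! ### Power series in the Levi-Civita field -/

/-- `1 + c X ^ 2` has a square root with constant coefficient `1`. -/
theorem PowerSeries.exists_sq_eq_one_add_X_sq (c : ℝ) :
    ∃ s : PowerSeries ℝ, s ^ 2 = 1 + PowerSeries.C c * PowerSeries.X ^ 2 ∧
      PowerSeries.constantCoeff s = 1 := by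
  -- `b` is the series of `(1 + X) ^ (1/2)`; exponents add under multiplication, so its square is `1
  -- + X`. Rescaling by `c` and then substituting `X ^ 2` for `X` yields the root.
  let b : PowerSeries ℝ := PowerSeries.binomialSeries ℝ (1 / 2 : ℝ)
  have hb : b ^ 2 = 1 + PowerSeries.X := by
    rw [sq, ← PowerSeries.binomialSeries_add]
    norm_num
    simpa using PowerSeries.binomialSeries_nat (R := ℝ) (A := ℝ) 1
  refine ⟨PowerSeries.expand 2 two_ne_zero (PowerSeries.rescale c b), ?_, ?_⟩
  · rw [← map_pow, ← map_pow, hb]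
    simp [PowerSeries.expand_C]
  · rw [PowerSeries.expand_apply, PowerSeries.constantCoeff_subst_X_pow two_ne_zero]
    simp [b, ← PowerSeries.coeff_zero_eq_constantCoeff_apply]

theorem PowerSeries.support_ofPowerSeries_subset (f : PowerSeries ℝ) :
    (HahnSeries.ofPowerSeries ℚ ℝ f).support ⊆ Set.range (Nat.cast : ℕ → ℚ) := by
  rw [HahnSeries.ofPowerSeries_apply]
  exact HahnSeries.support_embDomain_subset.trans (Set.image_subset_range _ _)

theorem LeftFinite.range_natCast : LeftFinite (Set.range (Nat.cast : ℕ → ℚ)) := by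
  intro r
  obtain ⟨N, hN⟩ := exists_nat_gt r
  refine ((Set.finite_Iio N).image (Nat.cast : ℕ → ℚ)).subset ?_
  rintro _ ⟨⟨k, rfl⟩, hk⟩
  refine ⟨k, ?_, rfl⟩
  have : (k : ℚ) < N := lt_trans hk hN
  exact_mod_cast this

namespace LeviCivita

/-- The power series in `τ` as elements of the Levi-Civita field. -/
noncomputable def ofPowerSeries : PowerSeries ℝ →+* LeviCivita where
  toFun f := ⟨toLex (HahnSeries.ofPowerSeries ℚ ℝ f),
    LeftFinite.range_natCast.mono f.support_ofPowerSeries_subset⟩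
  map_one' := Subtype.ext (congrArg toLex (map_one (HahnSeries.ofPowerSeries ℚ ℝ)))
  map_zero' := Subtype.ext (congrArg toLex (map_zero (HahnSeries.ofPowerSeries ℚ ℝ)))
  map_mul' f g := Subtype.ext (congrArg toLex (map_mul (HahnSeries.ofPowerSeries ℚ ℝ) f g))
  map_add' f g := Subtype.ext (congrArg toLex (map_add (HahnSeries.ofPowerSeries ℚ ℝ) f g))

theorem ofPowerSeries_C (c : ℝ) : ofPowerSeries (PowerSeries.C c) = ofReal c :=
  Subtype.ext (congrArg toLex (HahnSeries.ofPowerSeries_C (Γ := ℚ) c))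

theorem ofPowerSeries_X : ofPowerSeries PowerSeries.X = τ :=
  Subtype.ext (congrArg toLex (HahnSeries.ofPowerSeries_X (Γ := ℚ) (R := ℝ)))

theorem coeff_ofPowerSeries_natCast (f : PowerSeries ℝ) (n : ℕ) :
    (ofPowerSeries f).coeff n = PowerSeries.coeff n f :=
  HahnSeries.ofPowerSeries_apply_coeff f n

theorem exists_nat_of_coeff_ofPowerSeries_ne_zero {f : PowerSeries ℝ} {q : ℚ}
    (h : (ofPowerSeries f).coeff q ≠ 0) : ∃ k : ℕ, q = k := by
  obtain ⟨k, hk⟩ := f.support_ofPowerSeries_subset h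
  exact ⟨k, hk.symm⟩

theorem coeff_ofPowerSeries_of_neg (f : PowerSeries ℝ) {q : ℚ} (hq : q < 0) :
    (ofPowerSeries f).coeff q = 0 := by
  by_contra h
  obtain ⟨k, rfl⟩ := exists_nat_of_coeff_ofPowerSeries_ne_zero h
  exact absurd hq (not_lt.mpr k.cast_nonneg)

theorem lt_iff_coeff {x y : LeviCivita} :
    x < y ↔ ∃ q, (∀ r < q, x.coeff r = y.coeff r) ∧ x.coeff q < y.coeff q :=
  HahnSeries.lt_iff _ _

theorem coeff_zero (q : ℚ) : coeff 0 q = 0 := rfl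

theorem coeff_neg (x : LeviCivita) (q : ℚ) : (-x).coeff q = -x.coeff q := rfl

theorem ofPowerSeries_pos {f : PowerSeries ℝ} (hf : 0 < PowerSeries.constantCoeff f) :
    0 < ofPowerSeries f := by
  refine lt_iff_coeff.mpr ⟨0, fun r hr => ?_, ?_⟩
  · rw [coeff_ofPowerSeries_of_neg f hr, coeff_zero]
  · have h := coeff_ofPowerSeries_natCast f 0
    rw [Nat.cast_zero, PowerSeries.coeff_zero_eq_constantCoeff_apply] at h
    rwa [coeff_zero, h]

theorem ofPowerSeries_inv {f : PowerSeries ℝ} (hf : PowerSeries.constantCoeff f ≠ 0) :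
    ofPowerSeries f⁻¹ = (ofPowerSeries f)⁻¹ := by
  refine eq_inv_of_mul_eq_one_right ?_
  rw [← map_mul, PowerSeries.mul_inv_cancel f hf, map_one]

theorem monomial_mul_monomial (p q : ℚ) (c d : ℝ) :
    monomial p c * monomial q d = monomial (p + q) (c * d) :=
  Subtype.ext (congrArg toLex HahnSeries.single_mul_single)

theorem τ_zpow (m : ℤ) : τ ^ m = monomial m 1 := by
  have hnat : ∀ k : ℕ, τ ^ k = monomial k 1 := by
    intro k
    induction k with
    | zero => rw [pow_zero, Nat.cast_zero]; rfl
    | succ k ih => rw [pow_succ, ih, τ, monomial_mul_monomial, Nat.cast_succ, one_mul]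
  obtain ⟨k, rfl | rfl⟩ := m.eq_nat_or_neg
  · rw [zpow_natCast, hnat, Int.cast_natCast]
  · rw [zpow_neg, zpow_natCast, hnat]
    refine inv_eq_of_mul_eq_one_left ?_
    rw [monomial_mul_monomial]
    simp only [Int.cast_neg, Int.cast_natCast, neg_add_cancel, one_mul]
    rfl

theorem coeff_τ_zpow_mul (m : ℤ) (x : LeviCivita) (q : ℚ) :
    (τ ^ m * x).coeff q = x.coeff (q - m) := by
  rw [τ_zpow]
  have h := HahnSeries.coeff_single_mul_add (r := (1 : ℝ)) (x := ofLex (x : Lex (HahnSeries ℚ ℝ)))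
    (a := q - m) (b := (m : ℚ))
  rw [sub_add_cancel, one_mul] at h
  exact h

theorem isLittleOTau_τ_zpow_mul_ofPowerSeries {m k : ℤ} (h : m < k) (f : PowerSeries ℝ) :
    (τ ^ k * ofPowerSeries f).IsLittleOTau m := by
  intro q hq
  rw [coeff_τ_zpow_mul] at hq
  obtain ⟨j, hj⟩ := exists_nat_of_coeff_ofPowerSeries_ne_zero hq
  refine ⟨k + j, by omega, ?_⟩
  push_cast
  linarith

/-- The leading exponent of `ε` is at most `m`, so both `x` and `-x` vanish there and below, and the
positive leading coefficient of `ε` decides the comparison. -/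
theorem abs_lt_of_coeff_eq_zero {x ε : LeviCivita} {m : ℚ} (hx : ∀ q ≤ m, x.coeff q = 0)
    (hε0 : 0 < ε) (hε : ε.coeff m ≠ 0) : |x| < ε := by
  obtain ⟨q, hlt, hq⟩ := lt_iff_coeff.mp hε0
  have hqm : q ≤ m := not_lt.mp fun h => hε (hlt m h).symm
  rw [abs_eq_max_neg, max_lt_iff, lt_iff_coeff, lt_iff_coeff]
  refine ⟨⟨q, fun r hr => ?_, ?_⟩, ⟨q, fun r hr => ?_, ?_⟩⟩
  · rw [hx r (hr.le.trans hqm), ← hlt r hr, coeff_zero]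
  · rwa [hx q hqm]
  · rw [coeff_neg, hx r (hr.le.trans hqm), ← hlt r hr, coeff_zero, neg_zero]
  · rwa [coeff_neg, hx q hqm, neg_zero]

/-- A sequence tends to `0` if its `n`-th term is `τ ^ m n` times a power series in `τ` and
`m n → ∞`. -/
theorem tendsto_τ_zpow_mul_ofPowerSeries {ι : Type*} {l : Filter ι} {m : ι → ℤ}
    (hm : Tendsto m l atTop) (f : ι → PowerSeries ℝ) :
    Tendsto (fun i => τ ^ m i * ofPowerSeries (f i)) l (𝓝 0) := by
  rw [LinearOrderedAddCommGroup.tendsto_nhds]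
  intro ε hε
  -- Any exponent `q` at which `ε` has a nonzero coefficient serves as threshold: once `m i > q`,
  -- the `i`-th term has no coefficients up to `q`.
  obtain ⟨q, -, hq⟩ := lt_iff_coeff.mp hε
  filter_upwards [hm.eventually_gt_atTop ⌈q⌉] with i hi
  rw [sub_zero]
  refine abs_lt_of_coeff_eq_zero (m := q) (fun r hr => ?_) hε hq.ne'
  rw [coeff_τ_zpow_mul]
  refine coeff_ofPowerSeries_of_neg _ ?_
  have h1 : (⌈q⌉ : ℚ) < m i := by exact_mod_cast hi
  linarith [Int.le_ceil q]

end LeviCivita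

/-! ### The ladder over the Levi-Civita field -/

/-- The effective admittance of a finite ladder, by means of a positive square root `ξ` of
`β / α + (β / (2 α)) ^ 2`. -/
theorem effectiveAdmittance_exhaustion_ladderNetwork_sub {K : Type*} [Field K] [LinearOrder K]
    [IsStrictOrderedRing K] (α β : K) (hα : 0 < α) (hβ : 0 < β) (ξ : K) (hξ : 0 < ξ)
    (hsq : ξ ^ 2 = β / α + (β / (2 * α)) ^ 2) (n : ℕ+) :
    ((ladderNetwork α β hα hβ).exhaustion n).effectiveAdmittance - β / (β / (2 * α) + ξ) =
      2 * α * ξ / ((1 + β / (2 * α) + ξ) ^ (2 * (n : ℕ)) - 1) := by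
  -- In terms of `b` the hypothesis reads `ξ² = 2b + b²`. Hence `1 + b + ξ` and `1 + b - ξ` have sum
  -- `2(1 + b)` and product `1`: they are the two characteristic roots.
  obtain ⟨b, hb⟩ : ∃ b, b = β / (2 * α) := ⟨_, rfl⟩
  have hb0 : 0 < b := hb ▸ by positivity
  have hβb : β = 2 * α * b := by
    rw [hb]
    field_simp
  have hsq' : ξ ^ 2 = 2 * b + b ^ 2 := by
    rw [hsq, hb]
    field_simp
  rw [← hb]
  have hψ : α * ((1 + b + ξ) ^ 2 + 1) = (2 * α + β) * (1 + b + ξ) := by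
    rw [hβb]
    linear_combination α * hsq'
  have hinv : (1 + b + ξ)⁻¹ = 1 + b - ξ := by
    refine inv_eq_of_mul_eq_one_right ?_
    linear_combination -hsq'
  have hdiv : β / (b + ξ) = α * (ξ - b) := by
    rw [div_eq_iff (by positivity), hβb]
    linear_combination -α * hsq'
  rw [effectiveAdmittance_exhaustion_ladderNetwork_of_root α β hα hβ n _ (by linarith) hψ, hinv,
    hdiv]
  ring

namespace LeviCivita

variable {L C : ℝ}

theorem ofReal_ne_zero {c : ℝ} (hc : 0 < c) : ofReal c ≠ 0 := (ofReal_pos hc).ne'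

theorem ofReal_mul (c d : ℝ) : ofReal (c * d) = ofReal c * ofReal d := by
  simp only [← ofPowerSeries_C, map_mul]

theorem ofReal_inv {c : ℝ} (hc : 0 < c) : ofReal c⁻¹ = (ofReal c)⁻¹ := by
  refine eq_inv_of_mul_eq_one_left ?_
  rw [← ofReal_mul, inv_mul_cancel₀ hc.ne']
  rfl

/-- The positive square root of `β / α + (β / (2 α)) ^ 2` is `β / (2 α)` times a power series
in `τ` with constant coefficient `1`. -/
theorem exists_powerSeries_sqrt (hL : 0 < L) (hC : 0 < C) :
    ∃ s : PowerSeries ℝ, PowerSeries.constantCoeff s = 1 ∧ ∀ ξ : LeviCivita,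
      (0 < ξ ∧ ξ ^ 2 = capacitorAdmittance C / coilAdmittance L +
        (capacitorAdmittance C / (2 * coilAdmittance L)) ^ 2) ↔
      ξ = capacitorAdmittance C / (2 * coilAdmittance L) * ofPowerSeries s := by
  -- Factoring out `(β/(2α))²` leaves `1 + 4α/β`, and `4α/β = 4 (CL)⁻¹ τ²`.
  obtain ⟨s, hs, hs1⟩ := PowerSeries.exists_sq_eq_one_add_X_sq (4 * (C * L)⁻¹)
  refine ⟨s, hs1, fun ξ => ?_⟩
  have hl := ofReal_pos hL
  have hk := ofReal_pos hC
  have hτ := τ_pos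
  have hspos : 0 < ofPowerSeries s := ofPowerSeries_pos (by rw [hs1]; exact one_pos)
  have hs' := congrArg ofPowerSeries hs
  have h4 : ofReal 4 = 4 := by
    rw [← ofPowerSeries_C, map_ofNat, map_ofNat]
  rw [map_pow, map_add, map_one, map_mul, map_pow, ofPowerSeries_X, ofPowerSeries_C, ofReal_mul,
    ofReal_inv (mul_pos hC hL), ofReal_mul, h4] at hs'
  set ξ₀ := capacitorAdmittance C / (2 * coilAdmittance L) * ofPowerSeries s with hξ₀
  have hpos : 0 < ξ₀ := by
    rw [hξ₀, capacitorAdmittance, coilAdmittance, ofReal_inv hL]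
    positivity
  have hsq : ξ₀ ^ 2 = capacitorAdmittance C / coilAdmittance L +
      (capacitorAdmittance C / (2 * coilAdmittance L)) ^ 2 := by
    rw [hξ₀, mul_pow, hs', capacitorAdmittance, coilAdmittance, ofReal_inv hL]
    field_simp
    ring
  constructor
  · rintro ⟨h0, h⟩
    exact (pow_left_inj₀ h0.le hpos.le two_ne_zero).mp (h.trans hsq.symm)
  · rintro rfl
    exact ⟨hpos, hsq⟩

/-- The deviation of the `n`-th effective admittance from the limit is `τ ^ (4 n - 1)` times a
power series in `τ`. -/
theorem exists_deviation_eq_τ_zpow_mul_ofPowerSeries (hL : 0 < L) (hC : 0 < C)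
    {s : PowerSeries ℝ} (hs : PowerSeries.constantCoeff s = 1) {b : LeviCivita}
    (hb : b = capacitorAdmittance C / (2 * coilAdmittance L)) {n : ℕ} (hn : 0 < n) :
    ∃ f : PowerSeries ℝ, PowerSeries.constantCoeff f = C / (C * L) ^ (2 * n) ∧
      2 * coilAdmittance L * (b * ofPowerSeries s) /
        ((1 + b + b * ofPowerSeries s) ^ (2 * n) - 1) =
      τ ^ (4 * (n : ℤ) - 1) * ofPowerSeries f := by
  -- `p` and `d` clear the poles: with `b = (CL/2) τ⁻²`, the root is `τ⁻² p` and the denominator is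
  -- `τ ^ (-4n) d`. The numerator is `β s = C τ⁻¹ s`, so the quotient series is `C s d⁻¹`.
  let p : PowerSeries ℝ := PowerSeries.X ^ 2 + PowerSeries.C (C * L / 2) * (1 + s)
  let d : PowerSeries ℝ := p ^ (2 * n) - PowerSeries.X ^ (4 * n)
  have hd : PowerSeries.constantCoeff d = (C * L) ^ (2 * n) := by
    -- Positivity of `n` matters here: for `n = 0` the series `d` would be zero rather than
    -- invertible.
    have h4 : 4 * n ≠ 0 := by omega
    simp only [d, p, map_sub, map_add, map_mul, map_pow, map_one, hs, PowerSeries.constantCoeff_X,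
      PowerSeries.constantCoeff_C, zero_pow two_ne_zero, zero_pow h4]
    ring
  have hd0 : 0 < PowerSeries.constantCoeff d := hd ▸ by positivity
  refine ⟨PowerSeries.C C * s * d⁻¹, ?_, ?_⟩
  · rw [map_mul, map_mul, PowerSeries.constantCoeff_inv, hd, hs, PowerSeries.constantCoeff_C,
      mul_one, div_eq_mul_inv]
  · have hl := ofReal_ne_zero hL
    have hτ := τ_pos.ne'
    have hdne : ofPowerSeries d ≠ 0 := (ofPowerSeries_pos hd0).ne'
    have hbτ : b = ofReal (C * L / 2) * (τ ^ 2)⁻¹ := by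
      have h2 : ofReal 2 = 2 := by
        rw [← ofPowerSeries_C, map_ofNat, map_ofNat]
      rw [hb, div_eq_mul_inv (C * L), ofReal_mul, ofReal_mul, ofReal_inv two_pos, h2,
        capacitorAdmittance, coilAdmittance, ofReal_inv hL]
      field_simp
    have hψ : 1 + b + b * ofPowerSeries s = (τ ^ 2)⁻¹ * ofPowerSeries p := by
      simp only [p, map_add, map_mul, map_pow, map_one, ofPowerSeries_X, ofPowerSeries_C]
      rw [hbτ]
      field_simp
      ring
    have hden : (1 + b + b * ofPowerSeries s) ^ (2 * n) - 1 = (τ ^ (4 * n))⁻¹ * ofPowerSeries d := by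
      rw [hψ, mul_pow, inv_pow, ← pow_mul, show 2 * (2 * n) = 4 * n by ring]
      simp only [d, map_sub, map_pow, ofPowerSeries_X]
      field_simp
    have hnum : 2 * coilAdmittance L * b = ofReal C * τ⁻¹ := by
      rw [hb, capacitorAdmittance, coilAdmittance, ofReal_inv hL]
      field_simp
    rw [hden, ← mul_assoc, hnum, map_mul, map_mul, ofPowerSeries_inv hd0.ne', ofPowerSeries_C,
      zpow_sub₀ hτ, zpow_one, show (4 * (n : ℤ)) = ((4 * n : ℕ) : ℤ) by push_cast; ring,
      zpow_natCast]
    field_simp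

end LeviCivita

theorem mainTheorem9 (L C : ℝ) (hL : 0 < L) (hC : 0 < C) (α β : LeviCivita)
    (hα : α = coilAdmittance L) (hβ : β = capacitorAdmittance C) :
    (∃! ξ : LeviCivita, 0 < ξ ∧ ξ ^ 2 = β / α + (β / (2 * α)) ^ 2) ∧
    ∀ ξ : LeviCivita, 0 < ξ → ξ ^ 2 = β / α + (β / (2 * α)) ^ 2 →
      Tendsto (fun n : ℕ+ => ((feynmanLadder L C hL hC).exhaustion n).effectiveAdmittance)
        atTop (𝓝 (β / (β / (2 * α) + ξ))) ∧
      ∀ n : ℕ+,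
        ((feynmanLadder L C hL hC).exhaustion n).effectiveAdmittance - β / (β / (2 * α) + ξ) =
            2 * α * ξ / ((1 + β / (2 * α) + ξ) ^ (2 * (n : ℕ)) - 1) ∧
        ∃ r : LeviCivita, r.IsLittleOTau (4 * (n : ℤ) - 1) ∧
          2 * α * ξ / ((1 + β / (2 * α) + ξ) ^ (2 * (n : ℕ)) - 1) =
            LeviCivita.ofReal (C / (C * L) ^ (2 * (n : ℕ))) * LeviCivita.τ ^ (4 * (n : ℤ) - 1)
              + r := by

  subst hα hβ
  obtain ⟨s, hs, hsqrt⟩ := LeviCivita.exists_powerSeries_sqrt hL hC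
  refine ⟨⟨_, (hsqrt _).mpr rfl, fun ξ hξ => (hsqrt ξ).mp hξ⟩, fun ξ hξ0 hξ => ?_⟩
  have hdiff := fun n : ℕ+ =>
    effectiveAdmittance_exhaustion_ladderNetwork_sub (coilAdmittance L) (capacitorAdmittance C)
      (mul_pos (LeviCivita.ofReal_pos (inv_pos.mpr hL)) LeviCivita.τ_pos)
      (mul_pos (LeviCivita.ofReal_pos hC) (inv_pos.mpr LeviCivita.τ_pos)) ξ hξ0 hξ n
  have hseries := fun n : ℕ+ =>
    LeviCivita.exists_deviation_eq_τ_zpow_mul_ofPowerSeries hL hC hs rfl n.pos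
  -- Uniqueness of the positive root identifies the given `ξ` with the explicit product in
  -- `hseries`.
  rw [← (hsqrt ξ).mp ⟨hξ0, hξ⟩] at hseries
  choose f hf0 hf using hseries
  refine ⟨?_, fun n => ⟨hdiff n, ?_⟩⟩
  · rw [← tendsto_sub_nhds_zero_iff]
    have hm : Tendsto (fun n : ℕ+ => 4 * (n : ℤ) - 1) atTop atTop := by
      refine tendsto_atTop.mpr fun k => ?_
      filter_upwards [eventually_ge_atTop (⟨k.toNat + 1, Nat.succ_pos _⟩ : ℕ+)] with n hn
      have h1 : k.toNat + 1 ≤ (n : ℕ) := hn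
      have := Int.self_le_toNat k
      omega
    refine (LeviCivita.tendsto_τ_zpow_mul_ofPowerSeries hm f).congr fun n => ?_
    rw [← hf n]
    exact (hdiff n).symm
  -- Removing the constant coefficient from `f n` leaves a multiple of `X`; the extra factor `τ`
  -- raises `τ ^ (4n - 1)` to `τ ^ (4n)`, the first power allowed in the remainder.
  · obtain ⟨g, hg⟩ := PowerSeries.X_dvd_iff.mpr
      (show PowerSeries.constantCoeff (f n - PowerSeries.C (C / (C * L) ^ (2 * (n : ℕ)))) = 0 by
        rw [map_sub, hf0, PowerSeries.constantCoeff_C, sub_self])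
    refine ⟨LeviCivita.τ ^ (4 * (n : ℤ)) * LeviCivita.ofPowerSeries g,
      LeviCivita.isLittleOTau_τ_zpow_mul_ofPowerSeries (by omega) g, ?_⟩
    rw [hf n, sub_eq_iff_eq_add.mp hg, map_add, map_mul, LeviCivita.ofPowerSeries_C,
      LeviCivita.ofPowerSeries_X, zpow_sub₀ LeviCivita.τ_pos.ne', zpow_one]
    have := LeviCivita.τ_pos.ne'
    field_simp
    ring
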